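/- Let $q(m,n)=am^2+bmn+cn^2$ be a real binary quadratic form of discriminant $D=b^2-4ac>0$, and let $\mathcal T$ be its topograph. That is, the vertices of $\mathcal T$ are the superbases $\{v_1,v_2,v_3\}$ of $\mathbb Z^2$ ($v_1+v_2+v_3=0$, $\{v_1,v_2\}$ a basis of $\mathbb Z^2$), taken up to a global sign. Each basis $(v,w)$ of $\mathbb Z^2$ gives an oriented edge from $\{v,-w,w-v\}$ to $\{v,w,-v-w\}$, which separates the regions $\pm v$ and $\pm w$. The region of a primitive vector $\pm v$ has the label $q(v)$. An oriented edge that separates regions labelled $s,t$ and points away from a region labelled $r$ has the label $s+t-r$, which changes sign with the orientation. For a vertex, $r,s,t$ denote the labels of the three adjacent regions and $e,f,g$ the labels of the three adjacent edges (with any orientations). Let $E$ be an oriented edge with label $e_0$ and adjacent region labels $r_0,t_0$, and let the upper half $\mathcal T'$ be the connected component of $\mathcal T$ with $E$ removed that contains the target $V_0$ of $E$. Suppose that $\mathcal T'$ is admissible, i.e. every edge of $\mathcal T'$, oriented away from $V_0$, has a positive label, and $rstefg\ne 0$ at every vertex of $\mathcal T'$. Then both of the following series over the vertices of $\mathcal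 T'$ converge, one has $\left|\frac{\sqrt D}{e_0}\right|<1$, and $$\sum_{V\in\mathcal T'}\frac1{|rst|}=\frac1D\left(\frac{e_0}{r_0t_0}-\frac{2}{\sqrt D}\operatorname{arcsinh}\left(\frac{e_0}{r_0t_0}\cdot\frac{\sqrt D}{2}\right)\right),\qquad \sum_{V\in\mathcal T'}\frac1{|efg|}=\frac1D\left(\frac{1}{\sqrt D}\operatorname{arctanh}\left(\frac{\sqrt D}{e_0}\right)-\frac1{e_0}\right).$$ -/

import Mathlib

namespace Topograph

open scoped Pointwise

/-- `v, w` is a basis of the lattice `ℤ²`. -/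
def IsLatticeBasis (v w : ℤ × ℤ) : Prop :=
  ∃ b : Module.Basis (Fin 2) ℤ (ℤ × ℤ), b 0 = v ∧ b 1 = w

theorem IsLatticeBasis.neg_right {v w : ℤ × ℤ} (h : IsLatticeBasis v w) :
    IsLatticeBasis v (-w) := by
  obtain ⟨b, rfl, rfl⟩ := h
  exact ⟨b.unitsSMul ![1, -1], by simp [Module.Basis.unitsSMul_apply],
    by simp [Module.Basis.unitsSMul_apply]⟩

theorem IsLatticeBasis.det_sq {v w : ℤ × ℤ} (h : IsLatticeBasis v w) :
    (v.1 * w.2 - v.2 * w.1) ^ 2 = 1 := by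
  obtain ⟨b, rfl, rfl⟩ := h
  have hu := (Module.Basis.finTwoProd ℤ).isUnit_det b
  rw [Module.Basis.det_apply, Matrix.det_fin_two] at hu
  simp only [Module.Basis.toMatrix_apply, Module.Basis.coe_finTwoProd_repr] at hu
  rcases Int.isUnit_iff.1 hu with hu | hu <;> simp at hu <;> nlinarith

/-- Superbases of `ℤ²`: sets `{v, w, -v - w}` with `v, w` a basis. -/
def Superbase : Type :=
  {S : Finset (ℤ × ℤ) // ∃ v w : ℤ × ℤ, IsLatticeBasis v w ∧ S = {v, w, -v - w}}

/-- Two superbases are identified if they agree up to a global sign. -/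
instance superbaseSetoid : Setoid Superbase where
  r S S' := S'.1 = S.1 ∨ S'.1 = -S.1
  iseqv :=
    { refl := fun _ => Or.inl rfl
      symm := by
        rintro S S' (h | h)
        · exact Or.inl h.symm
        · right; rw [h, neg_neg]
      trans := by
        rintro S S' S'' (h | h) (h' | h')
        · left; rw [h', h]
        · right; rw [h', h]
        · right; rw [h', h]
        · left; rw [h', h, neg_neg] }

/-- The vertices of the topograph: superbases up to sign. -/
def Vertex : Type := Quotient superbaseSetoid

/-- The vertex given by the superbase `{v, w, -v - w}`. -/
def vertexOf (v w : ℤ × ℤ) (h : IsLatticeBasis v w) : Vertex :=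
  Quotient.mk superbaseSetoid ⟨{v, w, -v - w}, v, w, h, rfl⟩

/-- An oriented edge of the topograph, presented by a basis `(left, right)` of `ℤ²`. The edge
separates the regions `± left` and `± right`, and points from the region `± (left - right)` to the
region `± (left + right)`. -/
structure OrientedEdge where
  left : ℤ × ℤ
  right : ℤ × ℤ
  isBasis : IsLatticeBasis left right

/-- The source of the edge is the vertex `{left, -right, -left + right}`. -/
def OrientedEdge.source (E : OrientedEdge) : Vertex :=
  vertexOf E.left (-E.right) E.isBasis.neg_right

/-- The target of the edge is the vertex `{left, right, -left - right}`. -/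
def OrientedEdge.target (E : OrientedEdge) : Vertex :=
  vertexOf E.left E.right E.isBasis

/-- The reversed edge. -/
def OrientedEdge.reverse (E : OrientedEdge) : OrientedEdge :=
  ⟨E.left, -E.right, E.isBasis.neg_right⟩

theorem OrientedEdge.source_reverse (E : OrientedEdge) : E.reverse.source = E.target := by
  simp [OrientedEdge.source, OrientedEdge.target, OrientedEdge.reverse]

theorem OrientedEdge.target_reverse (E : OrientedEdge) : E.reverse.target = E.source := rfl

theorem OrientedEdge.source_ne_target (E : OrientedEdge) : E.source ≠ E.target := by
  obtain ⟨⟨a, b⟩, ⟨c, d⟩, h⟩ := E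
  have hd := h.det_sq
  simp only at hd
  intro hEq
  have hmem : ((a + c, b + d) : ℤ × ℤ) ∈ ({(a, b), -(c, d), -(a, b) - -(c, d)} : Finset (ℤ × ℤ)) ∨
      (-(a + c, b + d) : ℤ × ℤ) ∈ ({(a, b), -(c, d), -(a, b) - -(c, d)} : Finset (ℤ × ℤ)) := by
    rcases Quotient.exact hEq with h1 | h1 <;> simp only at h1
    · right
      rw [← h1]; simp; right; right; constructor <;> ring
    · left
      rw [← neg_neg ({(a, b), -(c, d), -(a, b) - -(c, d)} : Finset (ℤ × ℤ)), ← h1]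
      simp
      right; right; constructor <;> ring
  have hz : a * d - b * c ≠ 0 := by
    intro h0; rw [h0] at hd; norm_num at hd
  simp only [Finset.mem_insert, Finset.mem_singleton, Prod.mk.injEq, Prod.neg_mk, Prod.mk_sub_mk]
    at hmem
  rcases hmem with (⟨h1, h2⟩ | ⟨h1, h2⟩ | ⟨h1, h2⟩) | (⟨h1, h2⟩ | ⟨h1, h2⟩ | ⟨h1, h2⟩)
  · obtain rfl : c = 0 := by omega
    obtain rfl : d = 0 := by omega
    simp at hz
  · obtain rfl : a = -2 * c := by omega
    obtain rfl : b = -2 * d := by omega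
    apply hz; ring
  · obtain rfl : a = 0 := by omega
    obtain rfl : b = 0 := by omega
    simp at hz
  · obtain rfl : c = -2 * a := by omega
    obtain rfl : d = -2 * b := by omega
    apply hz; ring
  · obtain rfl : a = 0 := by omega
    obtain rfl : b = 0 := by omega
    simp at hz
  · obtain rfl : c = 0 := by omega
    obtain rfl : d = 0 := by omega
    simp at hz

/-- The underlying graph of a topograph. -/
def graph : SimpleGraph Vertex where
  Adj V W := ∃ E : OrientedEdge, E.source = V ∧ E.target = W
  symm := ⟨by
    rintro V W ⟨E, rfl, rfl⟩
    exact ⟨E.reverse, E.source_reverse, E.target_reverse⟩⟩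
  loopless := ⟨by
    rintro V ⟨E, h1, h2⟩
    exact E.source_ne_target (h1.trans h2.symm)⟩

/-- The upper half relative to the root `E`: the vertices of the connected component of the target
of `E` in the graph with the edge `E` removed. -/
def upperHalf (E : OrientedEdge) : Set Vertex :=
  {V | (graph.deleteEdges {s(E.source, E.target)}).Reachable E.target V}

/-! The labels of the topograph of a real binary quadratic form `q` on `ℤ²`; the region of
`± v` carries the label `q v`. -/

/-- The discriminant `b² - 4ac` of `q(m, n) = a m² + b m n + c n²`; it equals
`-ef - fg - eg` for the labels `e, f, g` of the edges oriented away from any vertex. -/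
noncomputable def discr (q : QuadraticMap ℤ (ℤ × ℤ) ℝ) : ℝ :=
  QuadraticMap.polar q (1, 0) (0, 1) ^ 2 - 4 * q (1, 0) * q (0, 1)

/-- The label of an oriented edge. If the edge separates regions labelled `s` and `t` and points
away from a region labelled `r`, then its label is `s + t - r`. -/
noncomputable def edgeLabel (q : QuadraticMap ℤ (ℤ × ℤ) ℝ) (E : OrientedEdge) : ℝ :=
  q E.left + q E.right - q (E.left - E.right)

/-- The product `rst` of the labels on the three regions adjacent to a vertex. -/
noncomputable def regionProd (q : QuadraticMap ℤ (ℤ × ℤ) ℝ) (V : Vertex) : ℝ :=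
  Quotient.lift (fun S : Superbase => ∏ x ∈ S.1, q x) (by
    rintro S S' (h | h)
    · simp only [h]
    · simp only [h, Finset.prod_neg_index, QuadraticMap.map_neg]) V

/-- The product `efg` of the labels on the three edges adjacent to a vertex, oriented away from
it: `s + t - r`, `t + r - s` and `r + s - t`, where `r, s, t` are the labels of the adjacent
regions. (Changing orientations changes the product only by a sign.) -/
noncomputable def edgeProd (q : QuadraticMap ℤ (ℤ × ℤ) ℝ) (V : Vertex) : ℝ :=
  Quotient.lift (fun S : Superbase => ∏ x ∈ S.1, ((∑ y ∈ S.1 \ {x}, q y) - q x)) (by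
    rintro S S' (h | h)
    · simp only [h]
    · simp only [h, Finset.prod_neg_index, QuadraticMap.map_neg]
      refine Finset.prod_congr rfl fun x _ => ?_
      have : (-S.1) \ {-x} = -(S.1 \ {x}) := by
        ext y; simp [neg_eq_iff_eq_neg]
      rw [this, Finset.sum_neg_index]
      simp only [QuadraticMap.map_neg]) V

/-- The upper half relative to the root `E` is admissible for `q`: every edge `E'` of it, oriented
from the root to infinity (that is, away from the vertex `V₀ = E.target`), has a positive label,
and no label of a region or of an edge adjacent to a vertex of it is zero. -/
def IsAdmissible (q : QuadraticMap ℤ (ℤ × ℤ) ℝ) (E : OrientedEdge) : Prop :=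
  (∀ E' : OrientedEdge, E'.source ∈ upperHalf E → E'.target ∈ upperHalf E →
      graph.dist E.target E'.source < graph.dist E.target E'.target → 0 < edgeLabel q E') ∧
    ∀ V ∈ upperHalf E, regionProd q V * edgeProd q V ≠ 0

end Topograph

/-! Write d = √D. An edge with label e between regions r, t has children labelled e + 2r and e + 2t,
and e² = D + 4rt at every edge. Read each claimed value as a function F of the edge: then F(edge)
equals the term at its target plus F at the two children. The transcendental part works because
artanh(d/e) is additive along the tree (`Real.artanh_div_add`, `Topograph.edge_telescope`); the rest
is rational algebra. Since arsinh of the stated argument is 2 artanh(d/e), one additive function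
serves both series.

The remainder after n levels vanishes because both F are multiples of the distance from artanh(d/e)
to one of its bounds d/e and de/(e² - d²). That distance is at most ε(n) artanh(d/e) at depth n,
where ε(n) → 0 since edge labels grow at least linearly with depth, while artanh(d/e) has the same
sum over every level (`BinaryWord.hasSum_of_telescoping`).

Two inputs remain: the upper half is the tree of binary words (`mem_upperHalf_iff`,
`target_descend_injective`), and admissibility makes r, t, e positive at the root, hence everywhere
above it. -/

/-! ### Bounds and addition formulas for artanh -/

open Real in
/-- `artanh (d / e)` as a logarithm. -/
theorem Real.artanh_div_eq_log {d e : ℝ} (hd : 0 < d) (hde : d < e) :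
    artanh (d / e) = 1 / 2 * log ((e + d) / (e - d)) := by
  have he : 0 < e := hd.trans hde
  have h1 : d / e < 1 := (div_lt_one he).2 hde
  have h0 : 0 < d / e := div_pos hd he
  rw [artanh_eq_half_log ⟨by linarith, h1.le⟩]
  congr 2
  have : e - d ≠ 0 := by linarith
  field_simp

theorem Real.div_le_artanh_div {d e : ℝ} (hd : 0 < d) (hde : d < e) :
    d / e ≤ artanh (d / e) := by
  have he : 0 < e := hd.trans hde
  have h1 : d / e < 1 := (div_lt_one he).2 hde
  have h0 : 0 < d / e := div_pos hd he
  rw [artanh_eq_half_log ⟨by linarith, h1.le⟩]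
  simpa using sum_range_le_log_div h0.le h1 1

/-- With x = d/e, a geometric series dominates the power series of artanh x, which gives x/(1 - x²).
-/
theorem Real.artanh_div_le {d e : ℝ} (hd : 0 < d) (hde : d < e) :
    artanh (d / e) ≤ d * e / (e ^ 2 - d ^ 2) := by
  have he : 0 < e := hd.trans hde
  have h1 : d / e < 1 := (div_lt_one he).2 hde
  have h0 : 0 < d / e := div_pos hd he
  rw [artanh_eq_half_log ⟨by linarith, h1.le⟩]
  refine (log_div_le_sum_range_add h0.le h1 0).trans_eq ?_
  have : e ^ 2 - d ^ 2 ≠ 0 := by nlinarith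
  have : 1 - (d / e) ^ 2 ≠ 0 := by
    rw [div_pow, one_sub_div (by positivity)]
    exact div_ne_zero this (by positivity)
  simp
  field_simp

/-- The addition theorem for `artanh` for arguments written as quotients. -/
theorem Real.artanh_div_add {d e f g : ℝ} (hd : 0 < d) (hde : d < e) (hdf : d < f) (hdg : d < g)
    (h : f * g + d ^ 2 = e * (f + g)) :
    artanh (d / e) = artanh (d / f) + artanh (d / g) := by
  rw [artanh_div_eq_log hd hde, artanh_div_eq_log hd hdf, artanh_div_eq_log hd hdg, ← mul_add,
    ← Real.log_mul]
  · congr 2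
    have h1 : e - d ≠ 0 := by linarith
    have h2 : f - d ≠ 0 := by linarith
    have h3 : g - d ≠ 0 := by linarith
    rw [div_mul_div_comm, div_eq_div_iff h1 (mul_ne_zero h2 h3)]
    linear_combination (2 * d) * h
  · exact (div_pos (by linarith) (by linarith)).ne'
  · exact (div_pos (by linarith) (by linarith)).ne'

/-- If tanh y = d/e, then sinh 2y = 2de/(e² - d²), and e² - d² = 4p. -/
theorem Real.arsinh_eq_two_mul_artanh {d e p : ℝ} (hd : 0 < d) (hde : d < e) (hp : 0 < p)
    (h : e ^ 2 = d ^ 2 + 4 * p) :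
    arsinh (e / p * (d / 2)) = 2 * artanh (d / e) := by
  have he : 0 < e := hd.trans hde
  have hs : √(1 + (e / p * (d / 2)) ^ 2) = (e ^ 2 - 2 * p) / (2 * p) := by
    rw [Real.sqrt_eq_iff_mul_self_eq_of_pos (div_pos (by nlinarith) (by positivity))]
    field_simp
    linear_combination (e ^ 2) * h
  rw [artanh_div_eq_log hd hde, ← Real.log_exp (arsinh _), exp_arsinh, hs]
  rw [← mul_assoc, mul_one_div_cancel two_ne_zero, one_mul]
  congr 1
  have h1 : e - d ≠ 0 := by linarith
  field_simp
  linear_combination e * h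

/-! ### Telescoping series over the binary tree -/

namespace BinaryWord

/-- The finite set of binary words of length `n`. -/
def ofLength : ℕ → Finset (List Bool)
  | 0 => {[]}
  | n + 1 => (ofLength n ×ˢ Finset.univ).image fun p => p.2 :: p.1

theorem mem_ofLength {n : ℕ} {w : List Bool} : w ∈ ofLength n ↔ w.length = n := by
  induction n generalizing w with
  | zero => simp [ofLength]
  | succ n ih => cases w <;> simp [ofLength, ih]

theorem sum_ofLength_succ (F : List Bool → ℝ) (n : ℕ) :
    ∑ w ∈ ofLength (n + 1), F w = ∑ w ∈ ofLength n, (F (true :: w) + F (false :: w)) := by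
  rw [ofLength, Finset.sum_image, Finset.sum_product]
  · simp
  · rintro ⟨w, b⟩ _ ⟨w', b'⟩ _ h
    simp_all

/-- The finite set of binary words of length less than `n`. -/
def lengthLT (n : ℕ) : Finset (List Bool) := (Finset.range n).biUnion ofLength

theorem mem_lengthLT {n : ℕ} {w : List Bool} : w ∈ lengthLT n ↔ w.length < n := by
  simp [lengthLT, mem_ofLength]

theorem sum_lengthLT_succ (f : List Bool → ℝ) (n : ℕ) :
    ∑ w ∈ lengthLT (n + 1), f w = ∑ w ∈ lengthLT n, f w + ∑ w ∈ ofLength n, f w := by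
  rw [← Finset.sum_union]
  · congr 1
    ext w
    simp only [Finset.mem_union, mem_lengthLT, mem_ofLength]
    omega
  · rw [Finset.disjoint_left]
    intro w
    simp only [mem_lengthLT, mem_ofLength]
    omega

/-- Telescoping along the levels of the binary tree. -/
theorem sum_lengthLT_add {f F : List Bool → ℝ}
    (hF : ∀ w, F w = f w + F (true :: w) + F (false :: w)) (n : ℕ) :
    ∑ w ∈ lengthLT n, f w + ∑ w ∈ ofLength n, F w = F [] := by
  induction n with
  | zero => simp [lengthLT, ofLength]
  | succ n ih =>
    rw [sum_lengthLT_succ, sum_ofLength_succ, ← ih, add_assoc, ← Finset.sum_add_distrib]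
    congr 1
    exact Finset.sum_congr rfl fun w _ => by rw [hF w]; ring

/-- A telescoping series over the binary tree, whose remainder is small compared with a quantity
that is additive on the tree. -/
theorem hasSum_of_telescoping {f F Φ : List Bool → ℝ} {ε : ℕ → ℝ} (hf : ∀ w, 0 ≤ f w)
    (hF : ∀ w, F w = f w + F (true :: w) + F (false :: w))
    (hΦ : ∀ w, Φ w = Φ (true :: w) + Φ (false :: w))
    (h0 : ∀ w, 0 ≤ F w) (hle : ∀ w, F w ≤ ε w.length * Φ w)
    (hε : Filter.Tendsto ε Filter.atTop (nhds 0)) : HasSum f (F []) := by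
  -- Additivity is telescoping with zero terms, so Φ has the same sum on every level.
  have hΦsum (n : ℕ) : ∑ w ∈ ofLength n, Φ w = Φ [] := by
    simpa using sum_lengthLT_add (f := 0) (F := Φ) (by simpa using hΦ) n
  have hrem (n : ℕ) : ∑ w ∈ ofLength n, F w ≤ ε n * Φ [] := by
    rw [← hΦsum n, Finset.mul_sum]
    refine Finset.sum_le_sum fun w hw => ?_
    simpa [mem_ofLength.1 hw] using hle w
  refine hasSum_of_isLUB_of_nonneg _ hf ⟨?_, ?_⟩
  · rintro _ ⟨s, rfl⟩
    have hs : s ⊆ lengthLT (s.sup List.length + 1) := fun w hw =>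
      mem_lengthLT.2 (Nat.lt_succ_of_le (Finset.le_sup (f := List.length) hw))
    refine (Finset.sum_le_sum_of_subset_of_nonneg hs fun w _ _ => hf w).trans ?_
    rw [← sum_lengthLT_add hF (s.sup List.length + 1)]
    exact le_add_of_nonneg_right (Finset.sum_nonneg fun w _ => h0 w)
  · intro b hb
    have hlim : Filter.Tendsto (fun n => b + ε n * Φ []) Filter.atTop (nhds b) := by
      simpa using (hε.mul_const (Φ [])).const_add b
    refine ge_of_tendsto' hlim fun n => ?_
    rw [← sum_lengthLT_add hF n]
    exact add_le_add (hb ⟨_, rfl⟩) (hrem n)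

end BinaryWord
-- Lattice bases and equality of vertices
namespace Topograph

open scoped Pointwise

theorem isLatticeBasis_of_det_sq {v w : ℤ × ℤ} (h : (v.1 * w.2 - v.2 * w.1) ^ 2 = 1) :
    IsLatticeBasis v w := by
  have hu : IsUnit ((Module.Basis.finTwoProd ℤ).det ![v, w]) := by
    rw [Module.Basis.det_apply, Matrix.det_fin_two]
    simp only [Module.Basis.toMatrix_apply, Module.Basis.coe_finTwoProd_repr]
    rw [sq, mul_self_eq_one_iff, mul_comm v.2] at h
    simpa [Int.isUnit_iff] using h
  obtain ⟨hli, hsp⟩ := (Module.Basis.is_basis_iff_det _).2 hu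
  exact ⟨Module.Basis.mk hli hsp.ge, by simp, by simp⟩

theorem IsLatticeBasis.add_right {v w : ℤ × ℤ} (h : IsLatticeBasis v w) :
    IsLatticeBasis v (v + w) :=
  isLatticeBasis_of_det_sq (by
    have := h.det_sq
    simp only [Prod.fst_add, Prod.snd_add]
    linear_combination this)

theorem IsLatticeBasis.add_left {v w : ℤ × ℤ} (h : IsLatticeBasis v w) :
    IsLatticeBasis (v + w) w :=
  isLatticeBasis_of_det_sq (by
    have := h.det_sq
    simp only [Prod.fst_add, Prod.snd_add]
    linear_combination this)

theorem IsLatticeBasis.det_ne_zero {v w : ℤ × ℤ} (h : IsLatticeBasis v w) :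
    v.1 * w.2 - v.2 * w.1 ≠ 0 := fun h0 => by simpa [h0] using h.det_sq

theorem vertexOf_eq_iff {v w v' w' : ℤ × ℤ} (h : IsLatticeBasis v w) (h' : IsLatticeBasis v' w') :
    vertexOf v w h = vertexOf v' w' h' ↔
      ({v', w', -v' - w'} : Finset (ℤ × ℤ)) = {v, w, -v - w} ∨
        ({v', w', -v' - w'} : Finset (ℤ × ℤ)) = -{v, w, -v - w} :=
  Quotient.eq (r := superbaseSetoid)

theorem vertexOf_comm {v w : ℤ × ℤ} (h : IsLatticeBasis v w) (h' : IsLatticeBasis w v) :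
    vertexOf v w h = vertexOf w v h' := by
  rw [vertexOf_eq_iff]
  left
  rw [Finset.insert_comm, neg_sub_left, neg_sub_left, add_comm]

theorem vertexOf_neg {v w : ℤ × ℤ} (h : IsLatticeBasis v w) (h' : IsLatticeBasis (-v) (-w)) :
    vertexOf v w h = vertexOf (-v) (-w) h' := by
  rw [vertexOf_eq_iff]
  right
  ext x
  simp [add_comm]

theorem vertexOf_congr {v w v' w' : ℤ × ℤ} (h : IsLatticeBasis v w) (h' : IsLatticeBasis v' w')
    (H : (v' = v ∧ w' = w) ∨ (v' = w ∧ w' = v) ∨ (v' = -v ∧ w' = -w) ∨ (v' = -w ∧ w' = -v)) :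
    vertexOf v w h = vertexOf v' w' h' := by
  rcases H with ⟨rfl, rfl⟩ | ⟨rfl, rfl⟩ | ⟨rfl, rfl⟩ | ⟨rfl, rfl⟩
  · rfl
  · exact vertexOf_comm _ _
  · exact vertexOf_neg _ _
  · have h'' : IsLatticeBasis w v := by
      simpa using isLatticeBasis_of_det_sq (v := w) (w := v) (by linear_combination h.det_sq)
    rw [vertexOf_comm h h'', vertexOf_neg]

/-! ### The upper half as a binary tree -/

namespace OrientedEdge

/-- The edge from the target of `E` that keeps the region on the left. -/
def leftChild (E : OrientedEdge) : OrientedEdge := ⟨E.left, E.left + E.right, E.isBasis.add_right⟩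

/-- The edge from the target of `E` that keeps the region on the right. -/
def rightChild (E : OrientedEdge) : OrientedEdge :=
  ⟨E.left + E.right, E.right, E.isBasis.add_left⟩

theorem source_leftChild (E : OrientedEdge) : E.leftChild.source = E.target := by
  unfold source target leftChild
  rw [vertexOf_eq_iff]
  left
  ext x
  have : -(E.left + E.right) = -E.left - E.right := by abel
  simp [this]
  tauto

theorem source_rightChild (E : OrientedEdge) : E.rightChild.source = E.target := by
  unfold source target rightChild
  rw [vertexOf_eq_iff]
  right
  ext x
  simp [sub_eq_add_neg, add_comm]
  tauto

/-- The three neighbours of the target of an edge. -/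
theorem target_of_source_eq {E E' : OrientedEdge} (h : E'.source = E.target) :
    E'.target = E.source ∨ E'.target = E.leftChild.target ∨ E'.target = E.rightChild.target := by
  obtain ⟨a, b, hab⟩ := E'
  obtain ⟨v, w, hvw⟩ := E
  have hne : a ≠ -b := by
    rintro rfl
    apply hab.det_ne_zero
    simp only [Prod.fst_neg, Prod.snd_neg]
    ring
  -- The source of `E'` contains a and -b, so up to a common sign these are two vectors of the
  -- superbase at the target of `E`; `hne` makes them distinct. The pair chosen decides which of the
  -- three neighbours is reached.
  have hmem : (a ∈ ({v, w, -v - w} : Finset (ℤ × ℤ)) ∧ -b ∈ ({v, w, -v - w} : Finset (ℤ × ℤ))) ∨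
      (-a ∈ ({v, w, -v - w} : Finset (ℤ × ℤ)) ∧ b ∈ ({v, w, -v - w} : Finset (ℤ × ℤ))) := by
    rcases (vertexOf_eq_iff _ _).1 h with h1 | h1
    · left
      simp only at h1
      constructor <;> rw [h1] <;> simp
    · right
      simp only at h1
      constructor <;> rw [h1] <;> simp
  suffices H : (vertexOf a b hab = vertexOf v (-w) hvw.neg_right) ∨
      (vertexOf a b hab = vertexOf v (v + w) hvw.add_right) ∨
      (vertexOf a b hab = vertexOf (v + w) w hvw.add_left) from H
  simp only [Finset.mem_insert, Finset.mem_singleton] at hmem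
  have key : ∀ {v' w'} (h' : IsLatticeBasis v' w'), ((v' = a ∧ w' = b) ∨ (v' = b ∧ w' = a) ∨
      (v' = -a ∧ w' = -b) ∨ (v' = -b ∧ w' = -a)) → vertexOf a b hab = vertexOf v' w' h' :=
    fun h' H => vertexOf_congr hab h' H
  refine Or.imp (key _) (Or.imp (key _) (key _)) ?_
  simp only [Prod.ext_iff, Prod.fst_add, Prod.snd_add, Prod.fst_neg, Prod.snd_neg, Prod.fst_sub,
    Prod.snd_sub, ne_eq] at hmem hne ⊢
  rcases hmem with ⟨h1 | h1 | h1, h2 | h2 | h2⟩ | ⟨h1 | h1 | h1, h2 | h2 | h2⟩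
  · exact (hne (by omega)).elim
  · exact Or.inl (Or.inl (by omega))
  · exact Or.inr (Or.inl (Or.inl (by omega)))
  · exact Or.inl (Or.inr (Or.inr (Or.inr (by omega))))
  · exact (hne (by omega)).elim
  · exact Or.inr (Or.inr (Or.inr (Or.inl (by omega))))
  · exact Or.inr (Or.inl (Or.inr (Or.inr (Or.inr (by omega)))))
  · exact Or.inr (Or.inr (Or.inr (Or.inr (Or.inl (by omega)))))
  · exact (hne (by omega)).elim
  · exact (hne (by omega)).elim
  · exact Or.inl (Or.inr (Or.inr (Or.inl (by omega))))
  · exact Or.inr (Or.inl (Or.inr (Or.inr (Or.inl (by omega)))))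
  · exact Or.inl (Or.inr (Or.inl (by omega)))
  · exact (hne (by omega)).elim
  · exact Or.inr (Or.inr (Or.inr (Or.inr (Or.inr (by omega)))))
  · exact Or.inr (Or.inl (Or.inr (Or.inl (by omega))))
  · exact Or.inr (Or.inr (Or.inl (by omega)))
  · exact (hne (by omega)).elim

/-- The edge reached from `E` by following a binary word, whose last letter comes first. -/
def descend (E : OrientedEdge) : List Bool → OrientedEdge
  | [] => E
  | true :: w => (E.descend w).leftChild
  | false :: w => (E.descend w).rightChild

theorem source_descend_cons (E : OrientedEdge) (b : Bool) (w : List Bool) :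
    (E.descend (b :: w)).source = (E.descend w).target := by
  cases b
  · exact source_rightChild _
  · exact source_leftChild _

theorem graph_adj_descend (E : OrientedEdge) (b : Bool) (w : List Bool) :
    graph.Adj (E.descend w).target (E.descend (b :: w)).target :=
  ⟨_, source_descend_cons E b w, rfl⟩

theorem target_of_source_eq_descend {E E' : OrientedEdge} {w : List Bool}
    (h : E'.source = (E.descend w).target) :
    (w = [] ∧ E'.target = E.source) ∨
      ∃ w', E'.target = (E.descend w').target ∧ ∃ b, w' = b :: w ∨ w = b :: w' := by
  rcases target_of_source_eq h with h | h | h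
  · cases w with
    | nil => exact Or.inl ⟨rfl, h⟩
    | cons b w => exact Or.inr ⟨w, by rw [h, source_descend_cons], b, Or.inr rfl⟩
  · exact Or.inr ⟨true :: w, h, true, Or.inl rfl⟩
  · exact Or.inr ⟨false :: w, h, false, Or.inl rfl⟩

/-- The determinant of the basis of an edge. -/
def det (E : OrientedEdge) : ℤ := E.left.1 * E.right.2 - E.left.2 * E.right.1

theorem det_descend (E : OrientedEdge) (w : List Bool) : (E.descend w).det = E.det := by
  induction w with
  | nil => rfl
  | cons b w ih =>
    rw [← ih]
    cases b <;> simp only [descend, det, leftChild, rightChild, Prod.fst_add, Prod.snd_add] <;> ring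

/-- The sum of the coordinates of a vector with respect to the basis of an edge. -/
def coordSum (E : OrientedEdge) (x : ℤ × ℤ) : ℤ :=
  E.det * (x.1 * (E.right.2 - E.left.2) - x.2 * (E.right.1 - E.left.1))

theorem coordSum_add (E : OrientedEdge) (x y : ℤ × ℤ) :
    E.coordSum (x + y) = E.coordSum x + E.coordSum y := by
  simp only [coordSum, Prod.fst_add, Prod.snd_add]; ring

theorem coordSum_neg (E : OrientedEdge) (x : ℤ × ℤ) : E.coordSum (-x) = -E.coordSum x := by
  simp only [coordSum, Prod.fst_neg, Prod.snd_neg]; ring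

theorem coordSum_sub (E : OrientedEdge) (x y : ℤ × ℤ) :
    E.coordSum (x - y) = E.coordSum x - E.coordSum y := by
  rw [sub_eq_add_neg, coordSum_add, coordSum_neg, sub_eq_add_neg]

theorem coordSum_left (E : OrientedEdge) : E.coordSum E.left = 1 := by
  rw [← E.isBasis.det_sq, coordSum, det]; ring

theorem coordSum_right (E : OrientedEdge) : E.coordSum E.right = 1 := by
  rw [← E.isBasis.det_sq, coordSum, det]; ring

/-- Passing to a child replaces a basis vector by the sum of both. This positivity singles out one
of the two signs of each superbase in the tree. -/
theorem coordSum_descend_pos (E : OrientedEdge) (w : List Bool) :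
    0 < E.coordSum (E.descend w).left ∧ 0 < E.coordSum (E.descend w).right := by
  induction w with
  | nil => simp [descend, coordSum_left, coordSum_right]
  | cons b w ih =>
    cases b <;> simp only [descend, leftChild, rightChild, coordSum_add] <;> omega

/-- The source of `E` contains ±(left - right), where `coordSum` vanishes; at a descendant its
values are positive, positive and negative. -/
theorem source_ne_target_descend (E : OrientedEdge) (w : List Bool) :
    E.source ≠ (E.descend w).target := by
  obtain ⟨h1, h2⟩ := E.coordSum_descend_pos w
  have h0 : E.coordSum (-E.left - -E.right) = 0 := by
    rw [coordSum_sub, coordSum_neg, coordSum_neg, coordSum_left, coordSum_right]; rfl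
  intro h
  have hmem : ∃ x ∈ ({(E.descend w).left, (E.descend w).right,
      -(E.descend w).left - (E.descend w).right} : Finset (ℤ × ℤ)), E.coordSum x = 0 := by
    rcases (vertexOf_eq_iff _ _).1 h with h | h
    · exact ⟨_, by rw [h]; simp, h0⟩
    · exact ⟨-(-E.left - -E.right), by rw [h]; exact Finset.neg_mem_neg (by simp), by
        rw [coordSum_neg, h0, neg_zero]⟩
  simp only [Finset.mem_insert, Finset.mem_singleton] at hmem
  obtain ⟨x, rfl | rfl | rfl, hx⟩ := hmem
  · omega
  · omega
  · rw [coordSum_sub, coordSum_neg] at hx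
    omega

/-- The basis is recovered from the vertex: its members are the two superbase vectors of positive
`coordSum`, and the determinant, constant along the tree, fixes their order. -/
theorem left_right_eq_of_target_descend_eq {E : OrientedEdge} {w w' : List Bool}
    (h : (E.descend w).target = (E.descend w').target) :
    (E.descend w).left = (E.descend w').left ∧ (E.descend w).right = (E.descend w').right := by
  obtain ⟨h1, h2⟩ := E.coordSum_descend_pos w
  obtain ⟨h1', h2'⟩ := E.coordSum_descend_pos w'
  have hd := (E.det_descend w).trans (E.det_descend w').symm
  have hd0 := (E.descend w').isBasis.det_ne_zero
  have h := (vertexOf_eq_iff _ _).1 h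
  simp only [det] at hd
  generalize (E.descend w).left = a at *
  generalize (E.descend w).right = b at *
  generalize (E.descend w').left = a' at *
  generalize (E.descend w').right = b' at *
  rcases h with h | h
  · have ha : a' ∈ ({a, b, -a - b} : Finset (ℤ × ℤ)) := by rw [← h]; simp
    have hb : b' ∈ ({a, b, -a - b} : Finset (ℤ × ℤ)) := by rw [← h]; simp
    simp only [Finset.mem_insert, Finset.mem_singleton] at ha hb
    rcases ha with rfl | rfl | rfl
    · rcases hb with rfl | rfl | rfl
      · exact absurd (by ring) hd0
      · exact ⟨rfl, rfl⟩
      · rw [coordSum_sub, coordSum_neg] at h2'; omega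
    · rcases hb with rfl | rfl | rfl
      · exact absurd (by linarith) hd0
      · exact absurd (by ring) hd0
      · rw [coordSum_sub, coordSum_neg] at h2'; omega
    · rw [coordSum_sub, coordSum_neg] at h1'; omega
  -- The opposite superbase has only one vector of positive `coordSum`, too few for a basis.
  · have key : ∀ x, 0 < E.coordSum x → x ∈ -({a, b, -a - b} : Finset (ℤ × ℤ)) → x = a + b := by
      intro x hx hmem
      simp only [Finset.mem_neg', Finset.mem_insert, Finset.mem_singleton, neg_eq_iff_eq_neg] at hmem
      rcases hmem with rfl | rfl | rfl
      · rw [coordSum_neg] at hx; omega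
      · rw [coordSum_neg] at hx; omega
      · abel
    have ha := key a' h1' (by rw [← h]; simp)
    have hb := key b' h2' (by rw [← h]; simp)
    rw [ha, hb] at hd0
    exact absurd (by ring) hd0

/-- This is the subtractive Euclidean algorithm: the basis vector with the larger `coordSum` is the
sum just formed, which reveals the latest letter. -/
theorem descend_left_right_injective {E : OrientedEdge} {w w' : List Bool}
    (hl : (E.descend w).left = (E.descend w').left)
    (hr : (E.descend w).right = (E.descend w').right) : w = w' := by
  have hbase : ∀ b w, (E.descend (b :: w)).left = E.left → (E.descend (b :: w)).right = E.right →
      False := by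
    intro b w hl hr
    obtain ⟨h1, h2⟩ := E.coordSum_descend_pos w
    replace hl := congrArg E.coordSum hl
    replace hr := congrArg E.coordSum hr
    cases b <;>
      simp only [descend, leftChild, rightChild, coordSum_add, coordSum_left, coordSum_right]
        at hl hr <;> omega
  induction w generalizing w' with
  | nil =>
    cases w' with
    | nil => rfl
    | cons b w' => exact (hbase b w' hl.symm hr.symm).elim
  | cons b w ih =>
    cases w' with
    | nil => exact (hbase b w hl hr).elim
    | cons b' w' =>
      obtain ⟨h1, h2⟩ := E.coordSum_descend_pos w
      obtain ⟨h1', h2'⟩ := E.coordSum_descend_pos w'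
      have hl' := congrArg E.coordSum hl
      have hr' := congrArg E.coordSum hr
      cases b <;> cases b' <;>
        simp only [descend, leftChild, rightChild, coordSum_add] at hl hr hl' hr'
      · rw [hr] at hl
        rw [ih (add_right_cancel hl) hr]
      · omega
      · omega
      · rw [hl] at hr
        rw [ih hl (add_left_cancel hr)]

theorem target_descend_injective (E : OrientedEdge) :
    Function.Injective fun w => (E.descend w).target := fun _ _ h =>
  let h' := left_right_eq_of_target_descend_eq h
  descend_left_right_injective h'.1 h'.2

/-- The upper half is the binary tree below the root. -/
theorem mem_upperHalf_iff {E : OrientedEdge} {V : Vertex} :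
    V ∈ upperHalf E ↔ ∃ w, (E.descend w).target = V := by
  constructor
  · rintro ⟨p⟩
    suffices H : ∀ {U V : Vertex} (_ : (graph.deleteEdges {s(E.source, E.target)}).Walk U V),
        (∃ w, (E.descend w).target = U) → ∃ w, (E.descend w).target = V from H p ⟨[], rfl⟩
    intro U V p
    induction p with
    | nil => exact id
    | cons hadj _ ih =>
      rintro ⟨w, rfl⟩
      apply ih
      rw [SimpleGraph.deleteEdges_adj] at hadj
      obtain ⟨⟨E', hs, rfl⟩, hnot⟩ := hadj
      -- The only way out of the tree is from its root through the deleted edge.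
      rcases target_of_source_eq_descend hs with ⟨rfl, ht⟩ | ⟨w', ht, -⟩
      · rw [ht] at hnot
        exact absurd Sym2.eq_swap hnot
      · exact ⟨w', ht.symm⟩
  · rintro ⟨w, rfl⟩
    induction w with
    | nil => exact SimpleGraph.Reachable.refl _
    | cons b w ih =>
      refine SimpleGraph.Reachable.trans ih (SimpleGraph.Adj.reachable ?_)
      rw [SimpleGraph.deleteEdges_adj]
      refine ⟨graph_adj_descend E b w, fun h => ?_⟩
      rcases Sym2.eq_iff.1 (Set.mem_singleton_iff.1 h) with ⟨h, -⟩ | ⟨-, h⟩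
      · exact source_ne_target_descend E _ h.symm
      · exact source_ne_target_descend E _ h.symm

theorem target_descend_mem_upperHalf (E : OrientedEdge) (w : List Bool) :
    (E.descend w).target ∈ upperHalf E := mem_upperHalf_iff.2 ⟨w, rfl⟩

/-- The vertices of the upper half correspond to binary words. -/
noncomputable def wordEquiv (E : OrientedEdge) : List Bool ≃ upperHalf E :=
  Equiv.ofBijective (fun w => ⟨_, E.target_descend_mem_upperHalf w⟩)
    ⟨fun _ _ h => E.target_descend_injective (congrArg Subtype.val h), fun V =>
      let ⟨w, hw⟩ := mem_upperHalf_iff.1 V.2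
      ⟨w, Subtype.ext hw⟩⟩

theorem coe_wordEquiv (E : OrientedEdge) (w : List Bool) :
    (E.wordEquiv w : Vertex) = (E.descend w).target := rfl

open Classical in
/-- The length of the word of a vertex in the upper half, and `0` outside the upper half. -/
noncomputable def depth (E : OrientedEdge) (V : Vertex) : ℕ :=
  if h : V ∈ upperHalf E then (E.wordEquiv.symm ⟨V, h⟩).length else 0

theorem depth_target_descend (E : OrientedEdge) (w : List Bool) :
    E.depth (E.descend w).target = w.length := by
  rw [depth, dif_pos (E.target_descend_mem_upperHalf w)]
  congr 1
  exact E.wordEquiv.symm_apply_apply w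

/-- The default depth 0 outside the upper half is harmless, as the only crossing is at the root,
also of depth 0. -/
theorem depth_le_of_adj {E : OrientedEdge} {V W : Vertex} (h : graph.Adj V W) :
    E.depth W ≤ E.depth V + 1 := by
  by_cases hW : W ∈ upperHalf E
  · obtain ⟨w, rfl⟩ := mem_upperHalf_iff.1 hW
    obtain ⟨E', hs, ht⟩ := h.symm
    rcases target_of_source_eq_descend hs with ⟨rfl, -⟩ | ⟨w', ht', b, rfl | rfl⟩
    · simp [depth_target_descend]
    · rw [← ht, ht', depth_target_descend, depth_target_descend, List.length_cons]
      omega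
    · rw [← ht, ht', depth_target_descend, depth_target_descend, List.length_cons]
  · rw [depth, dif_neg hW]
    exact Nat.zero_le _

/-- The distance is taken in the full graph, where walks may leave the upper half; `depth` rises by
at most one per step, which gives the lower bound. -/
theorem dist_target_descend (E : OrientedEdge) (w : List Bool) :
    graph.dist E.target (E.descend w).target = w.length := by
  have hwalk : ∃ p : graph.Walk E.target (E.descend w).target, p.length = w.length := by
    induction w with
    | nil => exact ⟨.nil, rfl⟩
    | cons b w ih =>
      obtain ⟨p, hp⟩ := ih
      exact ⟨p.concat (graph_adj_descend E b w), by simp [hp]⟩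
  obtain ⟨p, hp⟩ := hwalk
  refine le_antisymm (hp ▸ SimpleGraph.dist_le p) ?_
  obtain ⟨p', hp'⟩ := p.reachable.exists_walk_length_eq_dist
  have H : ∀ {U V : Vertex} (p : graph.Walk U V), E.depth V ≤ E.depth U + p.length := by
    intro U V p
    induction p with
    | nil => simp
    | cons h p ih =>
      have := depth_le_of_adj (E := E) h
      rw [SimpleGraph.Walk.length_cons]
      omega
  have := H p'
  rw [depth_target_descend, hp'] at this
  have h0 : E.depth E.target = 0 := E.depth_target_descend []
  omega

end OrientedEdge

open OrientedEdge

theorem IsLatticeBasis.ne {v w : ℤ × ℤ} (h : IsLatticeBasis v w) : v ≠ w := by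
  rintro rfl
  exact h.det_ne_zero (by ring)

theorem IsLatticeBasis.left_ne_neg_sub {v w : ℤ × ℤ} (h : IsLatticeBasis v w) : v ≠ -v - w := by
  intro hv
  have h1 := congrArg Prod.fst hv
  have h2 := congrArg Prod.snd hv
  simp only [Prod.fst_sub, Prod.snd_sub, Prod.fst_neg, Prod.snd_neg] at h1 h2
  have hd := h.det_sq
  rw [show w.1 = -2 * v.1 by omega, show w.2 = -2 * v.2 by omega] at hd
  ring_nf at hd
  omega

theorem IsLatticeBasis.right_ne_neg_sub {v w : ℤ × ℤ} (h : IsLatticeBasis v w) : w ≠ -v - w := by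
  have h' : IsLatticeBasis w v := isLatticeBasis_of_det_sq (by linear_combination h.det_sq)
  simpa only [neg_sub_left, add_comm] using h'.left_ne_neg_sub

/-! ### Labels of edges, regions and vertices -/

section Labels

variable (q : QuadraticMap ℤ (ℤ × ℤ) ℝ) (E : OrientedEdge)

/-- The edge label is the polar form of the basis; this is the parallelogram law. -/
theorem map_left_add_right : q (E.left + E.right) = q E.left + q E.right + edgeLabel q E := by
  have h := QuadraticMap.polar_neg_right q E.left E.right
  rw [QuadraticMap.polar, QuadraticMap.polar, QuadraticMap.map_neg, ← sub_eq_add_neg] at h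
  rw [edgeLabel]
  linarith

theorem edgeLabel_leftChild : edgeLabel q E.leftChild = edgeLabel q E + 2 * q E.left := by
  have h := map_left_add_right q E
  have h' : q (E.left - (E.left + E.right)) = q E.right := by
    rw [sub_add_cancel_left, QuadraticMap.map_neg]
  rw [edgeLabel, leftChild, h, h']
  ring

theorem edgeLabel_rightChild : edgeLabel q E.rightChild = edgeLabel q E + 2 * q E.right := by
  have h := map_left_add_right q E
  rw [edgeLabel, rightChild, h, add_sub_cancel_right]
  ring

theorem map_eq_coefficients (x : ℤ × ℤ) : q x = x.1 ^ 2 * q (1, 0) + x.2 ^ 2 * q (0, 1) +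
    x.1 * x.2 * QuadraticMap.polar q (1, 0) (0, 1) := by
  have hx : x = x.1 • (1, 0) + x.2 • (0, 1) := by ext <;> simp
  conv_lhs => rw [hx]
  rw [QuadraticMap.map_add (q : ℤ × ℤ → ℝ), QuadraticMap.map_smul, QuadraticMap.map_smul,
    QuadraticMap.polar_smul_left, QuadraticMap.polar_smul_right]
  simp only [zsmul_eq_mul, Int.cast_mul]
  ring

/-- The discriminant in terms of the labels at an edge. -/
theorem edgeLabel_sq : edgeLabel q E ^ 2 = discr q + 4 * (q E.left * q E.right) := by
  have hd : ((E.left.1 * E.right.2 - E.left.2 * E.right.1 : ℝ)) ^ 2 = 1 := by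
    exact_mod_cast E.isBasis.det_sq
  rw [edgeLabel, discr, map_eq_coefficients q E.left, map_eq_coefficients q E.right,
    map_eq_coefficients q (E.left - E.right)]
  push_cast [Prod.fst_sub, Prod.snd_sub]
  linear_combination
    (QuadraticMap.polar q (1, 0) (0, 1) ^ 2 - 4 * q (1, 0) * q (0, 1)) * hd

theorem prod_superbase (f : ℤ × ℤ → ℝ) :
    ∏ x ∈ ({E.left, E.right, -E.left - E.right} : Finset (ℤ × ℤ)), f x =
      f E.left * f E.right * f (-E.left - E.right) := by
  rw [Finset.prod_insert, Finset.prod_pair E.isBasis.right_ne_neg_sub, mul_assoc]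
  simp only [Finset.mem_insert, Finset.mem_singleton, not_or]
  exact ⟨E.isBasis.ne, E.isBasis.left_ne_neg_sub⟩

theorem sum_superbase (f : ℤ × ℤ → ℝ) :
    ∑ x ∈ ({E.left, E.right, -E.left - E.right} : Finset (ℤ × ℤ)), f x =
      f E.left + f E.right + f (-E.left - E.right) := by
  rw [Finset.sum_insert, Finset.sum_pair E.isBasis.right_ne_neg_sub, add_assoc]
  simp only [Finset.mem_insert, Finset.mem_singleton, not_or]
  exact ⟨E.isBasis.ne, E.isBasis.left_ne_neg_sub⟩

theorem map_neg_left_sub_right :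
    q (-E.left - E.right) = q E.left + q E.right + edgeLabel q E := by
  rw [← map_left_add_right, ← QuadraticMap.map_neg]
  congr 1
  abel

theorem regionProd_target : regionProd q E.target =
    q E.left * q E.right * (q E.left + q E.right + edgeLabel q E) := by
  rw [← map_neg_left_sub_right]
  exact prod_superbase E q

/-- The minus sign comes from `E` itself, which points into its target. -/
theorem edgeProd_target : edgeProd q E.target =
    -(edgeLabel q E * (edgeLabel q E + 2 * q E.left) * (edgeLabel q E + 2 * q E.right)) := by
  have h : edgeProd q E.target = ∏ x ∈ ({E.left, E.right, -E.left - E.right} : Finset (ℤ × ℤ)),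
      ((∑ y ∈ ({E.left, E.right, -E.left - E.right} : Finset (ℤ × ℤ)), q y) - 2 * q x) := by
    refine Finset.prod_congr rfl fun x hx => ?_
    rw [Finset.sum_sdiff_eq_sub (Finset.singleton_subset_iff.2 hx), Finset.sum_singleton]
    ring
  rw [h, prod_superbase, sum_superbase, map_neg_left_sub_right]
  ring

end Labels

/-! ### Positivity and growth of labels -/

section Admissible

variable {q : QuadraticMap ℤ (ℤ × ℤ) ℝ} {E : OrientedEdge}

/-- The word is nonempty because the source of the root edge lies outside the upper half. -/
theorem IsAdmissible.edgeLabel_descend_pos (h : IsAdmissible q E) (b : Bool) (w : List Bool) :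
    0 < edgeLabel q (E.descend (b :: w)) := by
  apply h.1
  · rw [source_descend_cons]
    exact E.target_descend_mem_upperHalf w
  · exact E.target_descend_mem_upperHalf _
  · rw [source_descend_cons, dist_target_descend, dist_target_descend]
    simp

theorem nonneg_of_forall_pos {e r : ℝ} (h : ∀ n : ℕ, 0 < e + 2 * (n + 1) * r) : 0 ≤ r := by
  by_contra! hr
  obtain ⟨n, hn⟩ := exists_nat_gt (e / (2 * -r))
  rw [div_lt_iff₀ (by linarith)] at hn
  have := h n
  nlinarith

/-- Edges along the boundary of one region carry labels in arithmetic progression with difference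
2r. If all are positive, then r ≥ 0, and r ≠ 0 by admissibility. -/
theorem IsAdmissible.left_pos (h : IsAdmissible q E) : 0 < q E.left := by
  have hne : q E.left ≠ 0 := by
    have := h.2 _ (E.target_descend_mem_upperHalf [])
    rw [descend, regionProd_target] at this
    exact left_ne_zero_of_mul (left_ne_zero_of_mul (left_ne_zero_of_mul this))
  have key (n : ℕ) : (E.descend (List.replicate n true)).left = E.left ∧
      edgeLabel q (E.descend (List.replicate n true)) = edgeLabel q E + 2 * n * q E.left := by
    induction n with
    | zero => simp [descend]
    | succ n ih =>
      rw [List.replicate_succ, descend, edgeLabel_leftChild, ih.2, ih.1]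
      refine ⟨ih.1, ?_⟩
      push_cast
      ring
  refine (nonneg_of_forall_pos (e := edgeLabel q E) fun n => ?_).lt_of_ne' hne
  have := h.edgeLabel_descend_pos true (List.replicate n true)
  rw [← List.replicate_succ, (key (n + 1)).2] at this
  exact_mod_cast this

theorem IsAdmissible.right_pos (h : IsAdmissible q E) : 0 < q E.right := by
  have hne : q E.right ≠ 0 := by
    have := h.2 _ (E.target_descend_mem_upperHalf [])
    rw [descend, regionProd_target] at this
    exact right_ne_zero_of_mul (left_ne_zero_of_mul (left_ne_zero_of_mul this))
  have key (n : ℕ) : (E.descend (List.replicate n false)).right = E.right ∧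
      edgeLabel q (E.descend (List.replicate n false)) = edgeLabel q E + 2 * n * q E.right := by
    induction n with
    | zero => simp [descend]
    | succ n ih =>
      rw [List.replicate_succ, descend, edgeLabel_rightChild, ih.2, ih.1]
      refine ⟨ih.1, ?_⟩
      push_cast
      ring
  refine (nonneg_of_forall_pos (e := edgeLabel q E) fun n => ?_).lt_of_ne' hne
  have := h.edgeLabel_descend_pos false (List.replicate n false)
  rw [← List.replicate_succ, (key (n + 1)).2] at this
  exact_mod_cast this

/-- If e ≤ 0, then e + 2r > 0 and e + 2t > 0 give 4rt > e², against e² = D + 4rt. -/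
theorem IsAdmissible.edgeLabel_pos (h : IsAdmissible q E) (hD : 0 < discr q) :
    0 < edgeLabel q E := by
  have h1 := h.edgeLabel_descend_pos true []
  have h2 := h.edgeLabel_descend_pos false []
  rw [descend, edgeLabel_leftChild, descend] at h1
  rw [descend, edgeLabel_rightChild, descend] at h2
  have h3 := edgeLabel_sq q E
  by_contra! he
  nlinarith [mul_pos h1 h2]

/-- Lower bounds for the labels in the upper half. -/
theorem label_descend_bounds {m : ℝ} (hm : 0 < m) (hl : m ≤ q E.left) (hr : m ≤ q E.right)
    (he : 0 < edgeLabel q E) (w : List Bool) :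
    m ≤ q (E.descend w).left ∧ m ≤ q (E.descend w).right ∧
      edgeLabel q E + 2 * m * w.length ≤ edgeLabel q (E.descend w) := by
  induction w with
  | nil => simpa [descend] using ⟨hl, hr⟩
  | cons b w ih =>
    obtain ⟨h1, h2, h3⟩ := ih
    have h4 : 0 ≤ 2 * m * (w.length : ℝ) := by positivity
    have h5 := map_left_add_right q (E.descend w)
    rw [List.length_cons, Nat.cast_succ]
    cases b
    · rw [descend, edgeLabel_rightChild]
      refine ⟨?_, h2, by linarith⟩
      rw [rightChild, h5]
      linarith
    · rw [descend, edgeLabel_leftChild]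
      refine ⟨h1, ?_, by linarith⟩
      rw [leftChild, h5]
      linarith

end Admissible

/-- Telescoping of the edge series along one vertex. -/
theorem edge_telescope {d e r t : ℝ} (hd : 0 < d) (he : 0 < e) (hr : 0 < r) (ht : 0 < t)
    (h : e ^ 2 = d ^ 2 + 4 * (r * t)) :
    Real.artanh (d / e) =
      Real.artanh (d / (e + 2 * r)) + Real.artanh (d / (e + 2 * t)) := by
  have hde : d < e := by nlinarith [mul_pos hr ht]
  apply Real.artanh_div_add hd hde (by linarith) (by linarith)
  linear_combination -h

/-! ### Summation of both series -/

open Real in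
theorem hasSum_upperHalf {q : QuadraticMap ℤ (ℤ × ℤ) ℝ} {E : OrientedEdge} {d : ℝ} (hd : 0 < d)
    (hD : discr q = d ^ 2) (hl : 0 < q E.left) (hr : 0 < q E.right) (he : 0 < edgeLabel q E) :
    HasSum (fun V : upperHalf E => 1 / |regionProd q V|)
      (1 / d ^ 2 * (edgeLabel q E / (q E.left * q E.right) -
        4 * artanh (d / edgeLabel q E) / d)) ∧
    HasSum (fun V : upperHalf E => 1 / |edgeProd q V|)
      (1 / d ^ 2 * (artanh (d / edgeLabel q E) / d - 1 / edgeLabel q E)) := by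
  set m := min (q E.left) (q E.right)
  have hm : 0 < m := lt_min hl hr
  have hb := label_descend_bounds hm (min_le_left _ _) (min_le_right _ _) he
  set e : List Bool → ℝ := fun w => edgeLabel q (E.descend w)
  set r : List Bool → ℝ := fun w => q (E.descend w).left
  set t : List Bool → ℝ := fun w => q (E.descend w).right
  have hrpos (w) : 0 < r w := hm.trans_le (hb w).1
  have htpos (w) : 0 < t w := hm.trans_le (hb w).2.1
  have hepos (w) : 0 < e w := lt_of_lt_of_le (by positivity) (hb w).2.2
  have hsq (w) : e w ^ 2 = d ^ 2 + 4 * (r w * t w) := hD ▸ edgeLabel_sq q (E.descend w)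
  have hde (w) : d < e w := by nlinarith [hsq w, mul_pos (hrpos w) (htpos w), hepos w]
  have hde0 : d < edgeLabel q E := hde []
  have het (w) : e (true :: w) = e w + 2 * r w := edgeLabel_leftChild q _
  have hef (w) : e (false :: w) = e w + 2 * t w := edgeLabel_rightChild q _
  have hrf (w) : r (false :: w) = r w + t w + e w := map_left_add_right q _
  have htt (w) : t (true :: w) = r w + t w + e w := map_left_add_right q _
  have hrt (w) : r (true :: w) = r w := rfl
  have htf (w) : t (false :: w) = t w := rfl
  have hart (w) : artanh (d / e w) = artanh (d / e (true :: w)) + artanh (d / e (false :: w)) := by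
    rw [het, hef]
    exact edge_telescope hd (hepos w) (hrpos w) (htpos w) (hsq w)
  have hφ0 (w) : 0 ≤ artanh (d / e w) := artanh_nonneg (div_pos hd (hepos w)).le
  -- Chosen so that F is c times (upper bound - artanh) for regions and c/4 times (artanh - lower
  -- bound) for edges.
  set c : ℝ := 4 / (d * d ^ 2)
  have hc : 0 < c := by positivity
  -- The two bounds differ by the factor d²/(e² - d²) times d/e, and e is at least the root label
  -- plus 2mn at depth n.
  set ε : ℕ → ℝ := fun n => d ^ 2 / ((edgeLabel q E + 2 * m * n) ^ 2 - d ^ 2)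
  have hε : Filter.Tendsto ε Filter.atTop (nhds 0) := by
    apply Filter.Tendsto.const_div_atTop
    apply Filter.tendsto_atTop_add_const_right
    refine (Filter.tendsto_pow_atTop two_ne_zero).comp ?_
    apply Filter.tendsto_atTop_add_const_left
    exact tendsto_natCast_atTop_atTop.const_mul_atTop (by positivity)
  have hgap (w) : 0 < e w ^ 2 - d ^ 2 := by nlinarith [hde w]
  -- The gap between the upper and the lower bound for `artanh` is small
  have hbound (w) : d * e w / (e w ^ 2 - d ^ 2) - d / e w ≤ ε w.length * artanh (d / e w) := by
    have h1 : d * e w / (e w ^ 2 - d ^ 2) - d / e w = d ^ 2 / (e w ^ 2 - d ^ 2) * (d / e w) := by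
      have := (hgap w).ne'
      have := (hepos w).ne'
      field_simp
      ring
    have h0 : 0 ≤ 2 * m * (w.length : ℝ) := by positivity
    have h2 : d ^ 2 / (e w ^ 2 - d ^ 2) ≤ ε w.length := by
      apply div_le_div_of_nonneg_left (by positivity)
      · nlinarith
      · gcongr
        exact (hb w).2.2
    rw [h1]
    exact mul_le_mul h2 (div_le_artanh_div hd (hde w)) (div_pos hd (hepos w)).le
      ((div_pos (by positivity) (hgap w)).le.trans h2)
  have hlow (w) := div_le_artanh_div hd (hde w)
  have hup (w) := artanh_div_le hd (hde w)
  have hreg (w) : e w / (r w * t w) = 4 / d * (d * e w / (e w ^ 2 - d ^ 2)) := by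
    rw [hsq, add_sub_cancel_left]
    have := (hrpos w).ne'
    have := (htpos w).ne'
    field_simp
  have hΦ (w) : c * artanh (d / e w) =
      c * artanh (d / e (true :: w)) + c * artanh (d / e (false :: w)) := by
    rw [hart]; ring
  constructor
  · rw [← E.wordEquiv.hasSum_iff]
    have hregF (w) : 1 / d ^ 2 * (e w / (r w * t w) - 4 * artanh (d / e w) / d) =
        c * (d * e w / (e w ^ 2 - d ^ 2) - artanh (d / e w)) := by
      rw [hreg]
      simp only [c]
      ring
    refine BinaryWord.hasSum_of_telescoping (ε := ε) (Φ := fun w => c * artanh (d / e w))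
      (F := fun w => 1 / d ^ 2 * (e w / (r w * t w) - 4 * artanh (d / e w) / d))
      (fun w => by dsimp only [Function.comp]; positivity) (fun w => ?_) hΦ (fun w => ?_)
      (fun w => ?_) hε
    · have h1 : |regionProd q (E.wordEquiv w)| = r w * t w * (r w + t w + e w) := by
        rw [coe_wordEquiv, regionProd_target]
        exact abs_of_pos (mul_pos (mul_pos (hrpos w) (htpos w))
          (add_pos (add_pos (hrpos w) (htpos w)) (hepos w)))
      simp only [Function.comp_apply, h1, hart w, het, hef, hrf, htt, hrt, htf]
      have hr' := hrpos w
      have ht' := htpos w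
      have he' := hepos w
      have hs : r w + t w + e w ≠ 0 := by positivity
      field_simp
      linear_combination d * hsq w
    · simp only [hregF]
      exact mul_nonneg hc.le (sub_nonneg.2 (hup w))
    · simp only [hregF]
      nlinarith [hbound w, hlow w]
  · rw [← E.wordEquiv.hasSum_iff]
    have hedgeF (w) : 1 / d ^ 2 * (artanh (d / e w) / d - 1 / e w) =
        c / 4 * (artanh (d / e w) - d / e w) := by
      simp only [c]
      field_simp
    refine BinaryWord.hasSum_of_telescoping (ε := ε) (Φ := fun w => c * artanh (d / e w))
      (F := fun w => 1 / d ^ 2 * (artanh (d / e w) / d - 1 / e w))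
      (fun w => by dsimp only [Function.comp]; positivity) (fun w => ?_) hΦ (fun w => ?_)
      (fun w => ?_) hε
    · have h1 : |edgeProd q (E.wordEquiv w)| = e w * (e w + 2 * r w) * (e w + 2 * t w) := by
        rw [coe_wordEquiv, edgeProd_target, abs_neg]
        have hr' := hrpos w
        have ht' := htpos w
        have he' := hepos w
        exact abs_of_pos (by positivity)
      simp only [Function.comp_apply, h1, hart w, het, hef]
      have hr' := hrpos w
      have ht' := htpos w
      have he' := hepos w
      have hs1 : e w + 2 * r w ≠ 0 := by positivity
      have hs2 : e w + 2 * t w ≠ 0 := by positivity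
      field_simp
      linear_combination d * hsq w
    · simp only [hedgeF]
      exact mul_nonneg (by positivity) (sub_nonneg.2 (hlow w))
    · simp only [hedgeF]
      -- Replacing c/4 by c is a harmless loss that lets the same Φ and ε serve both series.
      have h1 := hbound w
      have h2 := hup w
      have h3 := hlow w
      have h4 : 0 ≤ c * (d * e w / (e w ^ 2 - d ^ 2) - artanh (d / e w)) :=
        mul_nonneg hc.le (sub_nonneg.2 h2)
      have h5 : 0 ≤ c * (artanh (d / e w) - d / e w) := mul_nonneg hc.le (sub_nonneg.2 h3)
      have h6 := mul_le_mul_of_nonneg_left h1 hc.le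
      linarith

end Topograph

theorem theorem1p6 (q : QuadraticMap ℤ (ℤ × ℤ) ℝ) (D : ℝ) (hD : Topograph.discr q = D)
    (hpos : 0 < D) (E : Topograph.OrientedEdge) (hE : Topograph.IsAdmissible q E)
    (r₀ t₀ e₀ : ℝ) (hr₀ : r₀ = q E.left) (ht₀ : t₀ = q E.right)
    (he₀ : e₀ = Topograph.edgeLabel q E) :
    HasSum (fun V : Topograph.upperHalf E => 1 / |Topograph.regionProd q V|)
        (1 / D * (e₀ / (r₀ * t₀) - 2 * Real.arsinh (e₀ / (r₀ * t₀) * (√D / 2)) / √D)) ∧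
      √D / e₀ ∈ Set.Ioo (-1 : ℝ) 1 ∧
      HasSum (fun V : Topograph.upperHalf E => 1 / |Topograph.edgeProd q V|)
        (1 / D * (Real.artanh (√D / e₀) / √D - 1 / e₀)) := by
  have hd : 0 < √D := Real.sqrt_pos.2 hpos
  have hdD : √D ^ 2 = D := Real.sq_sqrt hpos.le
  have hl := hE.left_pos
  have hr := hE.right_pos
  have he := hE.edgeLabel_pos (hD ▸ hpos)
  have hsq := Topograph.edgeLabel_sq q E
  obtain ⟨h1, h2⟩ := Topograph.hasSum_upperHalf hd (hD.trans hdD.symm) hl hr he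
  rw [hD, ← hdD] at hsq
  rw [hdD] at h1 h2
  rw [← hr₀] at hl hsq h1
  rw [← ht₀] at hr hsq h1
  rw [← he₀] at he hsq h1 h2
  have hp := mul_pos hl hr
  have hde : √D < e₀ := by nlinarith
  refine ⟨?_, ⟨by linarith [div_pos hd he], (div_lt_one he).2 hde⟩, h2⟩
  rw [Real.arsinh_eq_two_mul_artanh hd hde hp hsq, ← mul_assoc]
  norm_num only
  exact h1
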